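/- Let $n\ge 1$ be an integer and let $\mathbb{B}_n$ be the open unit ball of $\mathbb{C}^n$ for the canonical Hermitian norm. Let $F_n^2$ be the full Fock space of $\mathbb{C}^n$, i.e. the Hilbert space with orthonormal basis $e_{i_1}\otimes\cdots\otimes e_{i_k}$ ($k\ge 0$, $1\le i_1,\dots,i_k\le n$; for $k=0$ this is the vacuum vector $1$), and let $S_1,\dots,S_n$ be the left creation operators, $S_j(e_{i_1}\otimes\cdots\otimes e_{i_k})=e_j\otimes e_{i_1}\otimes\cdots\otimes e_{i_k}$, $S_j(1)=e_j$. Let $F_n^\infty\subseteq\mathcal{B}(F_n^2)$ be the closure in the weak operator topology of the unital algebra generated by $S_1,\dots,S_n$, with the operator norm. For $\varphi\in F_n^\infty$ and $\lambda\in\mathbb{B}_n$ write $\varphi(\lambda)=\pi_\lambda(\varphi)$, where $\pi_\lambda$ is the unique unital algebra homomorphism $F_n^\infty\to\mathbb{C}$ that is continuous for the weak* topology (the restriction of the weak operator topology) and satisfies $\pi_\lambda(S_j)=\lambda_j$ for $j=1,\dots,n$. For $z,w\in\mathbb{B}_n$ there is a biholomorphic map $f$ of $\mathbb{B}_n$ onto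 itself with $f(z)=0$, and $\|f(w)\|_{\mathbb{C}^n}$ is the same for all such $f$; this common value is the Poincaré pseudohyperbolic distance $\rho(z,w)$. Then for all $z,w\in\mathbb{B}_n$ \[ \rho(z,w)=\max\left\{|\varphi(z)| : \varphi\in F_n^\infty,\ \|\varphi\|_{F_n^\infty}\le 1,\ \varphi(w)=0\right\}, \] and in particular this maximum is attained. -/

import Mathlib

/-- The open unit ball of `ℂⁿ` for the canonical Hermitian norm. -/
abbrev UnitBall (n : ℕ) : Set (EuclideanSpace ℂ (Fin n)) := Metric.ball 0 1

/-- Automorphisms of the ball: biholomorphic maps of the unit ball of `ℂⁿ` onto itself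
(the values of `f` outside of the ball are irrelevant). -/
def IsBallAutomorphism {n : ℕ} (f : EuclideanSpace ℂ (Fin n) → EuclideanSpace ℂ (Fin n)) : Prop :=
  DifferentiableOn ℂ f (UnitBall n) ∧ Set.MapsTo f (UnitBall n) (UnitBall n) ∧
    ∃ g : EuclideanSpace ℂ (Fin n) → EuclideanSpace ℂ (Fin n),
      DifferentiableOn ℂ g (UnitBall n) ∧ Set.MapsTo g (UnitBall n) (UnitBall n) ∧
        Set.InvOn g f (UnitBall n) (UnitBall n)

/-- All the values of the Euclidean distance between `0` and the image of `w` by an automorphism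
of the ball which maps `z` to `0`. -/
def pseudohyperbolicValues {n : ℕ} (z w : UnitBall n) : Set ℝ :=
  {r | ∃ f : EuclideanSpace ℂ (Fin n) → EuclideanSpace ℂ (Fin n),
    IsBallAutomorphism f ∧ f z = 0 ∧ r = dist 0 (f w)}

/-- The Poincaré pseudohyperbolic distance: the Euclidean distance between `0` and the image
of `w` by any automorphism of the ball which maps `z` to `0`. The set of values is a singleton,
and `sInf` reads off its element. -/
noncomputable def pseudohyperbolicDist {n : ℕ} (z w : UnitBall n) : ℝ :=
  sInf (pseudohyperbolicValues z w)

/-- The full Fock space of `ℂⁿ`, in coordinates: the Hilbert space completion of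
`⨁ₖ (ℂⁿ)^{⊗ k}` has the orthonormal basis `e_{i₁} ⊗ ⋯ ⊗ e_{iₖ}`, indexed by the words
`[i₁, …, iₖ]` in the letters `1, …, n`; the empty word is the vacuum vector. -/
abbrev FockSpace (n : ℕ) : Type := lp (fun _ : List (Fin n) => ℂ) 2

namespace FockSpace

/-- The basis vector `e_{i₁} ⊗ ⋯ ⊗ e_{iₖ}` of the word `α = [i₁, …, iₖ]`. -/
noncomputable def e {n : ℕ} (α : List (Fin n)) : FockSpace n := lp.single 2 α (1 : ℂ)

/-- The isometric embedding of `ℂ` on the line of a basis vector. -/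
noncomputable def line {n : ℕ} (α : List (Fin n)) : ℂ →ₗᵢ[ℂ] FockSpace n where
  toLinearMap := lp.lsingle (E := fun _ : List (Fin n) => ℂ) 2 α
  norm_map' c := lp.norm_single (E := fun _ : List (Fin n) => ℂ) (p := 2) (by norm_num) α c

theorem orthogonalFamily_line_cons {n : ℕ} (j : Fin n) :
    OrthogonalFamily ℂ (fun _ : List (Fin n) => ℂ) (fun α => line (j :: α)) := by
  intro α β h v w
  have h2 : (j :: α) ≠ (j :: β) := by simpa using h
  change inner ℂ (lp.single 2 (j :: α) v : FockSpace n) (lp.single 2 (j :: β) w) = 0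
  rw [lp.inner_single_left, lp.single_apply_ne _ _ _ h2, inner_zero_right]

/-- The left creation operator `S_j`, which maps `e_α` to `e_j ⊗ e_α`. -/
noncomputable def creation {n : ℕ} (j : Fin n) : FockSpace n →L[ℂ] FockSpace n :=
  (orthogonalFamily_line_cons j).linearIsometry.toContinuousLinearMap

theorem creation_e {n : ℕ} (j : Fin n) (α : List (Fin n)) : creation j (e α) = e (j :: α) :=
  (orthogonalFamily_line_cons j).linearIsometry_apply_single (1 : ℂ)

end FockSpace

open FockSpace in
/-- The noncommutative Hardy algebra `F_n^∞`: the closure, in the weak operator topology, of the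
unital algebra generated by the left creation operators. Its norm is the operator norm. -/
noncomputable def hardyAlgebra (n : ℕ) : Subalgebra ℂ (FockSpace n →L[ℂ] FockSpace n) :=
  (Algebra.adjoin ℂ (Set.range fun j : Fin n =>
    ContinuousLinearMapWOT.ofCLM (creation j))).topologicalClosure.map
      (ContinuousLinearMapWOT.algEquiv ℂ).toAlgHom

namespace hardyAlgebra

theorem mem_iff {n : ℕ} {A : FockSpace n →L[ℂ] FockSpace n} :
    A ∈ hardyAlgebra n ↔ ContinuousLinearMapWOT.ofCLM A ∈
      closure (Algebra.adjoin ℂ (Set.range fun j : Fin n =>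
        ContinuousLinearMapWOT.ofCLM (FockSpace.creation j)) :
          Set (FockSpace n →WOT[ℂ] FockSpace n)) := by
  constructor
  · rintro ⟨B, hB, rfl⟩
    exact hB
  · intro h
    exact ⟨_, h, rfl⟩

/-- The generator `S_j` as an element of `F_n^∞`. -/
noncomputable def S {n : ℕ} (j : Fin n) : hardyAlgebra n :=
  ⟨FockSpace.creation j, mem_iff.2 (subset_closure (Algebra.subset_adjoin ⟨j, rfl⟩))⟩

/-- An element of `F_n^∞` in the space of operators with the weak operator topology. -/
noncomputable def toWOT {n : ℕ} (φ : hardyAlgebra n) : FockSpace n →WOT[ℂ] FockSpace n :=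
  ContinuousLinearMapWOT.ofCLM (φ : FockSpace n →L[ℂ] FockSpace n)

/-- The weak* topology of `F_n^∞`, which is the restriction of the weak operator topology. -/
@[reducible]
noncomputable def weakStarTopology (n : ℕ) : TopologicalSpace (hardyAlgebra n) :=
  TopologicalSpace.induced toWOT inferInstance

open scoped Topology in
/-- `π` is a weak* scalar representation of `F_n^∞` with `π (S_j) = l_j` for all `j`. -/
def IsRepresentationAt {n : ℕ} (l : EuclideanSpace ℂ (Fin n)) (π : hardyAlgebra n →ₐ[ℂ] ℂ) : Prop :=
  Continuous[weakStarTopology n, inferInstanceAs (TopologicalSpace ℂ)] π ∧ ∀ j, π (S j) = l j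

theorem summable_words {n : ℕ} (l : UnitBall n) :
    Summable fun α : List (Fin n) => ‖(α.map l.1).prod‖ ^ 2 := by
  have hl : ∑ i, ‖l.1 i‖ ^ 2 < 1 := by
    have h1 : ‖l.1‖ < 1 := mem_ball_zero_iff.1 l.2
    rw [← EuclideanSpace.norm_sq_eq]
    nlinarith [norm_nonneg l.1]
  rw [← List.equivSigmaTuple.symm.summable_iff]
  have key : ∀ k (f : Fin k → Fin n),
      ‖((List.ofFn f).map l.1).prod‖ ^ 2 = ∏ i, ‖l.1 (f i)‖ ^ 2 := by
    intro k f
    rw [List.map_ofFn, List.prod_ofFn, norm_prod, Finset.prod_pow]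
    rfl
  rw [summable_sigma_of_nonneg]
  · refine ⟨fun k => Summable.of_finite, ?_⟩
    have : ∀ k, ∑' f : Fin k → Fin n, ‖((List.ofFn f).map l.1).prod‖ ^ 2
        = (∑ i, ‖l.1 i‖ ^ 2) ^ k := by
      intro k
      simp only [key]
      rw [tsum_fintype, Finset.sum_pow']
      simp
    refine (summable_geometric_of_lt_one (by positivity) hl).congr fun k => ?_
    exact (this k).symm
  · intro x
    exact sq_nonneg _

/-- The vector `∑_α conj (l_α) e_α`. -/
noncomputable def kernelVector {n : ℕ} (l : UnitBall n) : FockSpace n :=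
  ⟨fun α => star (α.map l.1).prod, by
    refine (memℓp_gen_iff (by norm_num)).2 ?_
    simpa using summable_words l⟩

theorem inner_kernelVector_e {n : ℕ} (l : UnitBall n) (α : List (Fin n)) :
    inner ℂ (kernelVector l) (FockSpace.e α) = (α.map l.1).prod := by
  rw [FockSpace.e, lp.inner_single_right]
  simp [kernelVector]

theorem inner_kernelVector_creation {n : ℕ} (l : UnitBall n) (j : Fin n) (x : FockSpace n) :
    inner ℂ (kernelVector l) (FockSpace.creation j x) = l.1 j * inner ℂ (kernelVector l) x := by
  have hx := lp.hasSum_single (p := 2) (by norm_num) x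
  have h1 := ((innerSL ℂ (kernelVector l)).comp (FockSpace.creation j)).hasSum hx
  have h2 := (l.1 j • innerSL ℂ (kernelVector l)).hasSum hx
  refine h1.unique ?_
  have h4 : (l.1 j • innerSL ℂ (kernelVector l)) x = l.1 j * inner ℂ (kernelVector l) x := rfl
  rw [h4] at h2
  convert h2 using 1
  funext α
  have h3 : (lp.single 2 α (x α) : FockSpace n) = x α • FockSpace.e α := by
    rw [FockSpace.e, ← lp.single_smul]; simp
  simp only [h3, map_smul, ContinuousLinearMap.comp_apply, FockSpace.creation_e,
    innerSL_apply_apply, inner_kernelVector_e, smul_apply, List.map_cons,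
    List.prod_cons, smul_eq_mul]

theorem inner_kernelVector_apply {n : ℕ} (l : UnitBall n) (φ : hardyAlgebra n) (x : FockSpace n) :
    inner ℂ (kernelVector l) (φ.1 x) =
      inner ℂ (kernelVector l) (φ.1 (FockSpace.e [])) * inner ℂ (kernelVector l) x := by
  have hclosed : IsClosed {A : FockSpace n →WOT[ℂ] FockSpace n | inner ℂ (kernelVector l) (A x) =
      inner ℂ (kernelVector l) (A (FockSpace.e [])) * inner ℂ (kernelVector l) x} := by
    have hc : ∀ y, Continuous fun A : FockSpace n →WOT[ℂ] FockSpace n =>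
        inner ℂ (kernelVector l) (A y) :=
      fun y => ContinuousLinearMapWOT.continuous_dual_apply y (innerSL ℂ (kernelVector l))
    exact isClosed_eq (hc x) ((hc _).mul continuous_const)
  refine closure_minimal ?_ hclosed (mem_iff.1 φ.2)
  intro A hA
  have key : ∃ c : ℂ, ∀ y, inner ℂ (kernelVector l) (A y) = c * inner ℂ (kernelVector l) y := by
    induction hA using Algebra.adjoin_induction with
    | mem A hA =>
      obtain ⟨j, rfl⟩ := hA
      exact ⟨l.1 j, inner_kernelVector_creation l j⟩
    | algebraMap r =>
      refine ⟨r, fun y => ?_⟩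
      rw [Algebra.algebraMap_eq_smul_one]
      exact inner_smul_right _ _ _
    | add A B _ _ hA hB =>
      obtain ⟨a, ha⟩ := hA
      obtain ⟨b, hb⟩ := hB
      refine ⟨a + b, fun y => ?_⟩
      rw [ContinuousLinearMapWOT.add_apply, inner_add_right, ha, hb, add_mul]
    | mul A B _ _ hA hB =>
      obtain ⟨a, ha⟩ := hA
      obtain ⟨b, hb⟩ := hB
      refine ⟨a * b, fun y => ?_⟩
      change inner ℂ (kernelVector l) (A (B y)) = _
      rw [ha, hb, mul_assoc]
  obtain ⟨c, hc⟩ := key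
  simp only [Set.mem_ofPred_eq, hc, inner_kernelVector_e]
  simp

theorem representation_unique {n : ℕ} {l : EuclideanSpace ℂ (Fin n)}
    {π π' : hardyAlgebra n →ₐ[ℂ] ℂ} (h : IsRepresentationAt l π) (h' : IsRepresentationAt l π') :
    π = π' := by
  let _ := weakStarTopology n
  have hcl : IsClosed {φ : hardyAlgebra n | π φ = π' φ} := isClosed_eq h.1 h'.1
  obtain ⟨C, hC, hCeq⟩ := isClosed_induced_iff.1 hcl
  have hsub : ∀ A ∈ Algebra.adjoin ℂ (Set.range fun j : Fin n =>
      ContinuousLinearMapWOT.ofCLM (FockSpace.creation j)),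
      ∃ φ : hardyAlgebra n, toWOT φ = A ∧ π φ = π' φ := by
    intro A hA
    induction hA using Algebra.adjoin_induction with
    | mem A hA =>
      obtain ⟨j, rfl⟩ := hA
      exact ⟨S j, rfl, by rw [h.2, h'.2]⟩
    | algebraMap r =>
      exact ⟨algebraMap ℂ _ r, rfl, by rw [AlgHom.commutes, AlgHom.commutes]⟩
    | add A B _ _ hA hB =>
      obtain ⟨φ, rfl, hφ⟩ := hA
      obtain ⟨ψ, rfl, hψ⟩ := hB
      exact ⟨φ + ψ, rfl, (π.map_add' φ ψ).trans ((congrArg₂ _ hφ hψ).trans (π'.map_add' φ ψ).symm)⟩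
    | mul A B _ _ hA hB =>
      obtain ⟨φ, rfl, hφ⟩ := hA
      obtain ⟨ψ, rfl, hψ⟩ := hB
      exact ⟨φ * ψ, rfl, (π.map_mul' φ ψ).trans ((congrArg₂ _ hφ hψ).trans (π'.map_mul' φ ψ).symm)⟩
  ext φ
  have hφ : toWOT φ ∈ C := by
    refine closure_minimal ?_ hC (mem_iff.1 φ.2)
    intro A hA
    obtain ⟨ψ, rfl, hψ⟩ := hsub A hA
    have : ψ ∈ toWOT ⁻¹' C := hCeq.symm ▸ hψ
    exact this
  have : φ ∈ {φ : hardyAlgebra n | π φ = π' φ} := hCeq ▸ hφ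
  exact this

theorem exists_representation {n : ℕ} (l : UnitBall n) :
    ∃ π : hardyAlgebra n →ₐ[ℂ] ℂ, IsRepresentationAt l.1 π := by
  have he : inner ℂ (kernelVector l) (FockSpace.e []) = (1 : ℂ) := by
    simp [inner_kernelVector_e]
  refine ⟨AlgHom.ofLinearMap
    { toFun := fun φ => inner ℂ (kernelVector l) (φ.1 (FockSpace.e []))
      map_add' := fun φ ψ => inner_add_right _ _ _
      map_smul' := fun c φ => inner_smul_right _ _ _ } he ?_, ?_, ?_⟩
  · intro φ ψ
    exact inner_kernelVector_apply l φ (ψ.1 (FockSpace.e []))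
  · have hc : Continuous fun A : FockSpace n →WOT[ℂ] FockSpace n =>
        inner ℂ (kernelVector l) (A (FockSpace.e [])) :=
      ContinuousLinearMapWOT.continuous_dual_apply _ (innerSL ℂ (kernelVector l))
    let _ := weakStarTopology n
    have ht : Continuous (toWOT (n := n)) := continuous_induced_dom
    exact hc.comp ht
  · intro j
    change inner ℂ (kernelVector l) (FockSpace.creation j (FockSpace.e [])) = l.1 j
    rw [inner_kernelVector_creation, he, mul_one]

/-- For every point `l` of the ball there is exactly one weak* scalar representation of `F_n^∞`
which maps `S_j` to `l_j` for all `j`. -/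
theorem existsUnique_representation {n : ℕ} (l : UnitBall n) :
    ∃! π : hardyAlgebra n →ₐ[ℂ] ℂ, IsRepresentationAt l.1 π := by
  obtain ⟨π, hπ⟩ := exists_representation l
  exact ⟨π, hπ, fun π' h' => representation_unique h' hπ⟩

/-- The weak* scalar representation `π_l` of `F_n^∞` with `π_l (S_j) = l_j`. -/
noncomputable def representationAt {n : ℕ} (l : UnitBall n) : hardyAlgebra n →ₐ[ℂ] ℂ :=
  (existsUnique_representation l).choose

/-- The value `φ(l) = π_l(φ)` of `φ ∈ F_n^∞` at the point `l` of the ball. -/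
noncomputable def eval {n : ℕ} (φ : hardyAlgebra n) (l : UnitBall n) : ℂ :=
  representationAt l φ

end hardyAlgebra

/-! Write `f_a` for the involution of the ball that exchanges `0` and `a`. By the Schwarz lemma
every automorphism sending `z` to `0` has the same norm at `w` as `f_z`, so the distance is
`‖f_z(w)‖`, with an explicit formula (`norm_sq_ballInvolution`) symmetric in `z` and `w`.

Upper bound: each kernel vector `k_l` is an eigenvector of `φ*`, with eigenvalue `conj φ(l)`. If
`φ(w) = 0`, the range of `φ` is orthogonal to `k_w`, so for a contraction `|φ(z)|` is at most the
sine of the angle between `k_z` and `k_w`. Computing the Gram matrix shows that this sine is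
`‖f_z(w)‖`.

Attainment: substitute the creation operators for the coordinates in `⟪c, f_w(·)⟫`, where `c` is the
unit vector along `f_w(z)`. The result `(1 - L_w)⁻¹ N` lies in the algebra; it is a contraction
because the identity computing `1 - ‖f_a‖²` survives for row contractions (`sum_norm_sq_sub_smul`).
-/

section Mobius

/-! ### Möbius involutions of the ball -/

variable {E : Type*} [NormedAddCommGroup E] [InnerProductSpace ℂ E]

/-- The involution of the unit ball which exchanges `0` and `a`. -/
noncomputable def ballInvolution (a z : E) : E :=
  (1 - inner ℂ a z)⁻¹ • (a - (√(1 - ‖a‖ ^ 2) : ℂ) • z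
    - (inner ℂ a z / (1 + √(1 - ‖a‖ ^ 2)) : ℂ) • a)

theorem one_sub_inner_ne_zero {a z : E} (ha : ‖a‖ < 1) (hz : ‖z‖ < 1) :
    1 - inner ℂ a z ≠ (0 : ℂ) := by
  intro h
  have h1 : ‖inner ℂ a z‖ ≤ ‖a‖ * ‖z‖ := norm_inner_le_norm a z
  rw [← sub_eq_zero.1 h, norm_one] at h1
  nlinarith [norm_nonneg a, norm_nonneg z]

theorem sq_sqrt_one_sub_norm_sq {E : Type*} [SeminormedAddCommGroup E] {a : E} (ha : ‖a‖ < 1) :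
    √(1 - ‖a‖ ^ 2) ^ 2 = 1 - ‖a‖ ^ 2 :=
  Real.sq_sqrt (by nlinarith [norm_nonneg a])

theorem one_add_sqrt_ne_zero (r : ℝ) : (1 + √r : ℂ) ≠ 0 := by
  have : 0 < 1 + √r := by positivity
  exact_mod_cast this.ne'

/-- With `s = √(1 - ‖a‖²)`, the classical numerator `a - P z - s (z - P z)`, `P` the projection on
`ℂ a`, takes the form used here because `(1 - s) / ‖a‖² = 1 / (1 + s)`. Thus `a = 0` is not a
special case. -/
theorem inner_ballInvolution {a z : E} (ha : ‖a‖ < 1) (hz : ‖z‖ < 1) :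
    inner ℂ a (ballInvolution a z) = ((‖a‖ : ℂ) ^ 2 - inner ℂ a z) / (1 - inner ℂ a z) := by
  have h1 := one_sub_inner_ne_zero ha hz
  have hs := one_add_sqrt_ne_zero (1 - ‖a‖ ^ 2)
  have hs2 : (√(1 - ‖a‖ ^ 2) : ℂ) ^ 2 = 1 - (‖a‖ : ℂ) ^ 2 := by
    exact_mod_cast sq_sqrt_one_sub_norm_sq ha
  simp only [ballInvolution, inner_smul_right, inner_sub_right, inner_self_eq_norm_sq_to_K]
  generalize (√(1 - ‖a‖ ^ 2) : ℂ) = s at *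
  simp only [Complex.coe_algebraMap]
  generalize (inner ℂ a z : ℂ) = t at *
  field_simp
  linear_combination (-t) * hs2

theorem ballInvolution_self {a : E} (ha : ‖a‖ < 1) : ballInvolution a a = 0 := by
  have hs := one_add_sqrt_ne_zero (1 - ‖a‖ ^ 2)
  have hs2 : (√(1 - ‖a‖ ^ 2) : ℂ) ^ 2 = 1 - (‖a‖ : ℂ) ^ 2 := by
    exact_mod_cast sq_sqrt_one_sub_norm_sq ha
  have : (1 - (√(1 - ‖a‖ ^ 2) : ℂ) - (inner ℂ a a / (1 + √(1 - ‖a‖ ^ 2)) : ℂ)) = 0 := by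
    rw [inner_self_eq_norm_sq_to_K]
    simp only [Complex.coe_algebraMap]
    generalize (√(1 - ‖a‖ ^ 2) : ℂ) = s at *
    field_simp
    linear_combination -hs2
  have h2 : a - (√(1 - ‖a‖ ^ 2) : ℂ) • a - (inner ℂ a a / (1 + √(1 - ‖a‖ ^ 2)) : ℂ) • a
      = (1 - (√(1 - ‖a‖ ^ 2) : ℂ) - (inner ℂ a a / (1 + √(1 - ‖a‖ ^ 2)) : ℂ)) • a := by
    module
  rw [ballInvolution, h2, this, zero_smul, smul_zero]

theorem ballInvolution_ballInvolution {a z : E} (ha : ‖a‖ < 1) (hz : ‖z‖ < 1) :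
    ballInvolution a (ballInvolution a z) = z := by
  have h1 := one_sub_inner_ne_zero ha hz
  have hs := one_add_sqrt_ne_zero (1 - ‖a‖ ^ 2)
  have hs2 : (√(1 - ‖a‖ ^ 2) : ℂ) ^ 2 = 1 - (‖a‖ : ℂ) ^ 2 := by
    exact_mod_cast sq_sqrt_one_sub_norm_sq ha
  have hs0 : (√(1 - ‖a‖ ^ 2) : ℂ) ≠ 0 := by
    have : 0 < √(1 - ‖a‖ ^ 2) := Real.sqrt_pos.2 (by nlinarith [norm_nonneg a])
    exact_mod_cast this.ne'
  rw [ballInvolution, inner_ballInvolution ha hz, ballInvolution]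
  generalize (√(1 - ‖a‖ ^ 2) : ℂ) = s at *
  have hr : (‖a‖ : ℂ) ^ 2 = 1 - s ^ 2 := by rw [hs2]; ring
  rw [hr]
  generalize (inner ℂ a z : ℂ) = t at *
  have h3 : 1 - (1 - s ^ 2 - t) / (1 - t) = s ^ 2 / (1 - t) := by field_simp; ring
  rw [h3]
  match_scalars
  · field_simp
    ring
  · field_simp

theorem norm_sq_ballInvolution {a z : E} (ha : ‖a‖ < 1) (hz : ‖z‖ < 1) :
    ‖ballInvolution a z‖ ^ 2
      = 1 - (1 - ‖a‖ ^ 2) * (1 - ‖z‖ ^ 2) / ‖1 - inner ℂ a z‖ ^ 2 := by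
  have h1 := one_sub_inner_ne_zero ha hz
  have h1' : ‖1 - inner ℂ a z‖ ^ 2 ≠ 0 := by simpa using h1
  have hs : 1 + √(1 - ‖a‖ ^ 2) ≠ 0 := by positivity
  have hs2 := sq_sqrt_one_sub_norm_sq ha
  have key : ‖a - (√(1 - ‖a‖ ^ 2) : ℂ) • z - (inner ℂ a z / (1 + √(1 - ‖a‖ ^ 2)) : ℂ) • a‖ ^ 2
      = ‖1 - inner ℂ a z‖ ^ 2 - (1 - ‖a‖ ^ 2) * (1 - ‖z‖ ^ 2) := by
    have e1 : ‖1 - inner ℂ a z‖ ^ 2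
        = 1 - 2 * (inner ℂ a z).re + ((inner ℂ a z).re ^ 2 + (inner ℂ a z).im ^ 2) := by
      rw [Complex.sq_norm, Complex.normSq_apply]; simp; ring
    have e2 : ‖a - (√(1 - ‖a‖ ^ 2) : ℂ) • z - (inner ℂ a z / (1 + √(1 - ‖a‖ ^ 2)) : ℂ) • a‖ ^ 2
        = (inner ℂ
          (a - (√(1 - ‖a‖ ^ 2) : ℂ) • z - (inner ℂ a z / (1 + √(1 - ‖a‖ ^ 2)) : ℂ) • a)
          (a - (√(1 - ‖a‖ ^ 2) : ℂ) • z - (inner ℂ a z / (1 + √(1 - ‖a‖ ^ 2)) : ℂ) • a)).re := by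
      rw [inner_self_eq_norm_sq_to_K]
      norm_cast
    rw [e2, e1]
    have hza : inner ℂ z a = (starRingEnd ℂ) (inner ℂ a z) := (inner_conj_symm z a).symm
    simp only [inner_sub_left, inner_sub_right, inner_smul_left, inner_smul_right, hza,
      inner_self_eq_norm_sq_to_K (𝕜 := ℂ) a, inner_self_eq_norm_sq_to_K (𝕜 := ℂ) z]
    generalize √(1 - ‖a‖ ^ 2) = s at *
    have hr : ‖a‖ ^ 2 = 1 - s ^ 2 := by rw [hs2]; ring
    have hsc : ((1 + s : ℝ) : ℂ) = 1 + (s : ℂ) := by push_cast; rfl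
    simp only [Complex.coe_algebraMap, ← Complex.ofReal_pow, hr, ← hsc]
    obtain ⟨x, y⟩ := (inner ℂ a z : ℂ)
    simp [Complex.div_re, Complex.div_im, Complex.normSq_apply, pow_two]
    field_simp
    ring
  rw [ballInvolution, norm_smul, mul_pow, key, norm_inv]
  field_simp

theorem norm_ballInvolution_lt_one {a z : E} (ha : ‖a‖ < 1) (hz : ‖z‖ < 1) :
    ‖ballInvolution a z‖ < 1 := by
  have h1 : 0 < ‖1 - inner ℂ a z‖ := norm_pos_iff.2 (one_sub_inner_ne_zero ha hz)
  have h2 : 0 < 1 - ‖a‖ ^ 2 := by nlinarith [norm_nonneg a]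
  have h3 : 0 < 1 - ‖z‖ ^ 2 := by nlinarith [norm_nonneg z]
  have h4 := norm_sq_ballInvolution ha hz
  have h5 : 0 < (1 - ‖a‖ ^ 2) * (1 - ‖z‖ ^ 2) / ‖1 - inner ℂ a z‖ ^ 2 := by positivity
  nlinarith [norm_nonneg (ballInvolution a z)]

theorem norm_ballInvolution_comm {a z : E} (ha : ‖a‖ < 1) (hz : ‖z‖ < 1) :
    ‖ballInvolution a z‖ = ‖ballInvolution z a‖ := by
  have h : ‖1 - inner ℂ a z‖ = ‖1 - inner ℂ z a‖ := by
    rw [← inner_conj_symm a z, ← Complex.norm_conj]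
    simp
  refine (sq_eq_sq₀ (norm_nonneg _) (norm_nonneg _)).1 ?_
  rw [norm_sq_ballInvolution ha hz, norm_sq_ballInvolution hz ha, h]
  ring

theorem differentiableOn_ballInvolution {a : E} (ha : ‖a‖ < 1) :
    DifferentiableOn ℂ (ballInvolution a) (Metric.ball 0 1) := by
  have hi : Differentiable ℂ fun z : E => (inner ℂ a z : ℂ) := (innerSL ℂ a).differentiable
  intro z hz
  have h1 := one_sub_inner_ne_zero ha (mem_ball_zero_iff.1 hz)
  have hiz : DifferentiableAt ℂ (fun z : E => (inner ℂ a z : ℂ)) z := hi z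
  have h2 : DifferentiableAt ℂ (fun z : E => (1 - inner ℂ a z : ℂ)⁻¹) z :=
    ((differentiableAt_const _).sub hiz).inv h1
  refine (h2.smul (DifferentiableAt.sub ?_ ?_)).differentiableWithinAt
  · fun_prop
  · exact DifferentiableAt.smul_const (by simpa only [div_eq_mul_inv] using hiz.mul_const _) a

end Mobius

/-! ### The pseudohyperbolic distance through the Schwarz lemma -/

theorem isBallAutomorphism_ballInvolution {n : ℕ} (a : UnitBall n) :
    IsBallAutomorphism (ballInvolution a.1) := by
  have ha : ‖a.1‖ < 1 := mem_ball_zero_iff.1 a.2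
  have hm : Set.MapsTo (ballInvolution a.1) (UnitBall n) (UnitBall n) := fun z hz =>
    mem_ball_zero_iff.2 (norm_ballInvolution_lt_one ha (mem_ball_zero_iff.1 hz))
  have hi : Set.LeftInvOn (ballInvolution a.1) (ballInvolution a.1) (UnitBall n) := fun z hz =>
    ballInvolution_ballInvolution ha (mem_ball_zero_iff.1 hz)
  exact ⟨differentiableOn_ballInvolution ha, hm, _, differentiableOn_ballInvolution ha, hm, hi, hi⟩

/-- The map `f ∘ g⁻¹` fixes `0` and preserves the ball, so the Schwarz lemma applies to it at `g w`.
Exchanging `f` and `g` gives equality. -/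
theorem IsBallAutomorphism.norm_le_norm {n : ℕ}
    {f g : EuclideanSpace ℂ (Fin n) → EuclideanSpace ℂ (Fin n)} (hf : IsBallAutomorphism f)
    (hg : IsBallAutomorphism g) {z w : EuclideanSpace ℂ (Fin n)} (hz : z ∈ UnitBall n)
    (hw : w ∈ UnitBall n) (hfz : f z = 0) (hgz : g z = 0) : ‖f w‖ ≤ ‖g w‖ := by
  obtain ⟨hfd, hfm, -⟩ := hf
  obtain ⟨-, hgm, h, hhd, hhm, hl, -⟩ := hg
  have h0 : (f ∘ h) 0 = 0 := by
    rw [Function.comp_apply, ← hgz, hl hz, hfz, hgz]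
  have := Complex.norm_le_norm_of_mapsTo_ball (hfd.comp hhd hhm)
    ((hfm.comp hhm).mono_right Metric.ball_subset_closedBall) h0 (mem_ball_zero_iff.1 (hgm hw))
  rwa [Function.comp_apply, hl hw] at this

theorem pseudohyperbolicValues_eq {n : ℕ} (z w : UnitBall n) :
    pseudohyperbolicValues z w = {‖ballInvolution z.1 w.1‖} := by
  have ha := isBallAutomorphism_ballInvolution z
  have h0 : ballInvolution z.1 z.1 = 0 := ballInvolution_self (mem_ball_zero_iff.1 z.2)
  ext r
  simp only [pseudohyperbolicValues, Set.mem_ofPred_eq, Set.mem_singleton_iff, dist_zero_left]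
  constructor
  · rintro ⟨f, hf, hfz, rfl⟩
    exact le_antisymm (hf.norm_le_norm ha z.2 w.2 hfz h0) (ha.norm_le_norm hf z.2 w.2 h0 hfz)
  · rintro rfl
    exact ⟨_, ha, h0, rfl⟩

theorem pseudohyperbolicDist_eq {n : ℕ} (z w : UnitBall n) :
    pseudohyperbolicDist z w = ‖ballInvolution z.1 w.1‖ := by
  rw [pseudohyperbolicDist, pseudohyperbolicValues_eq, csInf_singleton]

/-! ### Creation operators: isometries with orthogonal ranges -/

namespace FockSpace

variable {n : ℕ}

theorem inner_e_left (α : List (Fin n)) (x : FockSpace n) : inner ℂ (e α) x = x α := by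
  rw [e, lp.inner_single_left]
  simp

theorem ext_inner_e {x y : FockSpace n} (h : ∀ α, inner ℂ (e α) x = inner ℂ (e α) y) : x = y := by
  ext α
  rw [← inner_e_left, h, inner_e_left]

theorem hasSum_e (x : FockSpace n) : HasSum (fun α => x α • e α) x := by
  convert lp.hasSum_single (p := 2) (by norm_num) x using 2 with α
  rw [e, ← lp.single_smul]
  simp

theorem inner_creation_creation (j : Fin n) (x y : FockSpace n) :
    inner ℂ (creation j x) (creation j y) = inner ℂ x y :=
  (orthogonalFamily_line_cons j).linearIsometry.inner_map_map x y

theorem inner_e_e_of_ne {α β : List (Fin n)} (h : α ≠ β) : inner ℂ (e α) (e β) = 0 := by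
  rw [inner_e_left, e, lp.single_apply_ne _ _ _ h]

theorem inner_e_creation_eq_zero {α : List (Fin n)} {j : Fin n} (h : ∀ β, α ≠ j :: β)
    (x : FockSpace n) : inner ℂ (e α) (creation j x) = 0 := by
  have h1 := ((innerSL ℂ (e α)).comp (creation j)).hasSum (hasSum_e x)
  refine h1.unique ?_
  convert hasSum_zero with β
  simp [creation_e, inner_e_e_of_ne (h β)]

theorem inner_e_cons_creation (α : List (Fin n)) (j : Fin n) (x : FockSpace n) :
    inner ℂ (e (j :: α)) (creation j x) = x α := by
  rw [← creation_e, inner_creation_creation, inner_e_left]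

theorem inner_creation_creation_of_ne {i j : Fin n} (h : i ≠ j) (x y : FockSpace n) :
    inner ℂ (creation i x) (creation j y) = 0 := by
  have h1 := ((innerSL ℂ (creation j y)).comp (creation i)).hasSum (hasSum_e x)
  rw [← inner_conj_symm, map_eq_zero]
  refine h1.unique ?_
  convert hasSum_zero with β
  have : inner ℂ (e (i :: β)) (creation j y) = 0 :=
    inner_e_creation_eq_zero (by simp [h]) y
  rw [← inner_conj_symm, map_eq_zero] at this
  simp [creation_e, this]

theorem adjoint_creation_creation (i j : Fin n) (x : FockSpace n) :
    (creation i).adjoint (creation j x) = if i = j then x else 0 := by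
  refine ext_inner_left ℂ fun y => ?_
  rw [ContinuousLinearMap.adjoint_inner_right]
  split_ifs with h
  · rw [h, inner_creation_creation]
  · rw [inner_creation_creation_of_ne h, inner_zero_right]

/-- The creation operators are a row contraction. -/
theorem sum_norm_sq_adjoint_creation_le (y : FockSpace n) :
    ∑ j, ‖(creation j).adjoint y‖ ^ 2 ≤ ‖y‖ ^ 2 := by
  -- `u` is the orthogonal projection of `y` on the sum of the ranges, so `⟪u, y⟫ = ‖u‖²`, and the
  -- claim is `‖y - u‖² ≥ 0`.
  set u := ∑ j, creation j ((creation j).adjoint y) with hu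
  have h1 : inner ℂ u y = ((∑ j, ‖(creation j).adjoint y‖ ^ 2 : ℝ) : ℂ) := by
    rw [hu, sum_inner]
    push_cast
    refine Finset.sum_congr rfl fun j _ => ?_
    rw [← ContinuousLinearMap.adjoint_inner_right, inner_self_eq_norm_sq_to_K]
    rfl
  have h2 : inner ℂ u u = ((∑ j, ‖(creation j).adjoint y‖ ^ 2 : ℝ) : ℂ) := by
    rw [← h1]
    have hA : ∀ j, (creation j).adjoint u = (creation j).adjoint y := fun j => by
      simp [hu, map_sum, adjoint_creation_creation]
    have hB : ∀ x, inner ℂ u x = ∑ j, inner ℂ ((creation j).adjoint y) ((creation j).adjoint x) := by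
      intro x
      simp only [hu, sum_inner, ContinuousLinearMap.adjoint_inner_right]
    rw [hB u, hB y]
    simp only [hA]
  have h3 : ‖u‖ ^ 2 = ∑ j, ‖(creation j).adjoint y‖ ^ 2 := by
    rw [inner_self_eq_norm_sq_to_K] at h2
    simp only [Complex.coe_algebraMap] at h2
    exact_mod_cast h2
  have h4 : ‖y - u‖ ^ 2 = ‖y‖ ^ 2 - ∑ j, ‖(creation j).adjoint y‖ ^ 2 := by
    rw [@norm_sub_sq ℂ, h3, inner_re_symm, h1]
    simp only [RCLike.re_to_complex, Complex.ofReal_re]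
    ring
  nlinarith [sq_nonneg ‖y - u‖]

end FockSpace

/-! ### Kernel vectors and the upper bound -/

namespace hardyAlgebra

open FockSpace

variable {n : ℕ}

theorem kernelVector_apply (l : UnitBall n) (α : List (Fin n)) :
    kernelVector l α = star (α.map l.1).prod := rfl

/-- A nonempty word is a first letter followed by a word, and the coefficients are multiplicative.
-/
theorem kernelVector_eq (l : UnitBall n) :
    kernelVector l = e [] + ∑ j, star (l.1 j) • creation j (kernelVector l) := by
  refine ext_inner_e fun α => ?_
  rw [inner_add_right, inner_sum]
  simp only [inner_smul_right]
  rcases α with _ | ⟨i, α⟩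
  · rw [Finset.sum_eq_zero fun j _ => by rw [inner_e_creation_eq_zero (by simp), mul_zero]]
    rw [inner_e_left, inner_e_left, kernelVector_apply]
    simp [e]
  · rw [inner_e_e_of_ne (by simp), Finset.sum_eq_single i, inner_e_cons_creation, inner_e_left]
    · simp [kernelVector_apply, mul_comm]
    · intro j _ hj
      rw [inner_e_creation_eq_zero (by simp [hj.symm]), mul_zero]
    · simp

/-- The recursion for `k_w` gives `G = 1 + ⟪w, z⟫ G` for the inner product `G`, which sums the
geometric series. -/
theorem inner_kernelVector_kernelVector (z w : UnitBall n) :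
    inner ℂ (kernelVector z) (kernelVector w) = (1 - inner ℂ w.1 z.1)⁻¹ := by
  have h1 : (1 - inner ℂ w.1 z.1 : ℂ) ≠ 0 :=
    one_sub_inner_ne_zero (mem_ball_zero_iff.1 w.2) (mem_ball_zero_iff.1 z.2)
  have h2 : inner ℂ (kernelVector z) (kernelVector w)
      = 1 + inner ℂ w.1 z.1 * inner ℂ (kernelVector z) (kernelVector w) := by
    conv_lhs => rw [kernelVector_eq w]
    rw [inner_add_right, inner_sum, inner_kernelVector_e, PiLp.inner_apply, Finset.sum_mul]
    congr 1
    refine Finset.sum_congr rfl fun j _ => ?_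
    rw [inner_smul_right, inner_kernelVector_creation]
    simp
    ring
  refine eq_inv_of_mul_eq_one_left ?_
  linear_combination h2

theorem norm_sq_kernelVector (z : UnitBall n) :
    ‖kernelVector z‖ ^ 2 = (1 - ‖z.1‖ ^ 2)⁻¹ := by
  have h := inner_kernelVector_kernelVector z z
  rw [inner_self_eq_norm_sq_to_K, inner_self_eq_norm_sq_to_K] at h
  simp only [Complex.coe_algebraMap] at h
  exact_mod_cast h

theorem isRepresentationAt_representationAt (l : UnitBall n) :
    IsRepresentationAt l.1 (representationAt l) :=
  (existsUnique_representation l).choose_spec.1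

theorem eval_S (l : UnitBall n) (j : Fin n) : eval (S j) l = l.1 j :=
  (isRepresentationAt_representationAt l).2 j

/-- The vector functional on the right is itself a weak* representation at `l`, so uniqueness
identifies it with `π_l`. -/
theorem eval_eq_inner (φ : hardyAlgebra n) (l : UnitBall n) :
    eval φ l = inner ℂ (kernelVector l) (φ.1 (e [])) := by
  have he : inner ℂ (kernelVector l) (e []) = (1 : ℂ) := by
    simp [inner_kernelVector_e]
  let π : hardyAlgebra n →ₐ[ℂ] ℂ := AlgHom.ofLinearMap
    { toFun := fun φ => inner ℂ (kernelVector l) (φ.1 (e []))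
      map_add' := fun φ ψ => inner_add_right _ _ _
      map_smul' := fun c φ => inner_smul_right _ _ _ } he
    fun φ ψ => inner_kernelVector_apply l φ (ψ.1 (e []))
  have hπ : IsRepresentationAt l.1 π := by
    refine ⟨?_, fun j => ?_⟩
    · let _ := weakStarTopology n
      have ht : Continuous (toWOT (n := n)) := continuous_induced_dom
      exact (ContinuousLinearMapWOT.continuous_dual_apply (e [])
        (innerSL ℂ (kernelVector l))).comp ht
    · change inner ℂ (kernelVector l) (creation j (e [])) = l.1 j
      rw [inner_kernelVector_creation, he, mul_one]
  rw [eval, representation_unique (isRepresentationAt_representationAt l) hπ]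
  rfl

theorem inner_kernelVector_apply_eq_eval_mul (l : UnitBall n) (φ : hardyAlgebra n)
    (x : FockSpace n) :
    inner ℂ (kernelVector l) (φ.1 x) = eval φ l * inner ℂ (kernelVector l) x := by
  rw [inner_kernelVector_apply, eval_eq_inner]

theorem norm_eval_le {φ : hardyAlgebra n} (hφ : ‖φ‖ ≤ 1) {z w : UnitBall n}
    (hw : eval φ w = 0) : ‖eval φ z‖ ≤ ‖ballInvolution z.1 w.1‖ := by
  have hz1 : ‖z.1‖ < 1 := mem_ball_zero_iff.1 z.2
  have hw1 : ‖w.1‖ < 1 := mem_ball_zero_iff.1 w.2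
  have hz2 : 0 < 1 - ‖z.1‖ ^ 2 := by nlinarith [norm_nonneg z.1]
  have hw2 : 0 < 1 - ‖w.1‖ ^ 2 := by nlinarith [norm_nonneg w.1]
  set kz := kernelVector z
  set kw := kernelVector w
  have hkz : ‖kz‖ ^ 2 = (1 - ‖z.1‖ ^ 2)⁻¹ := norm_sq_kernelVector z
  have hkw : ‖kw‖ ^ 2 = (1 - ‖w.1‖ ^ 2)⁻¹ := norm_sq_kernelVector w
  have hkz0 : 0 < ‖kz‖ ^ 2 := by rw [hkz]; positivity
  have hkw0 : 0 < ‖kw‖ ^ 2 := by rw [hkw]; positivity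
  have hzw : ‖inner ℂ kw kz‖ ^ 2 = (‖1 - inner ℂ z.1 w.1‖ ^ 2)⁻¹ := by
    rw [inner_kernelVector_kernelVector, norm_inv, inv_pow]
  -- the component of `kz` orthogonal to `kw`
  set x := kz - (inner ℂ kw kz / (‖kw‖ : ℂ) ^ 2) • kw with hx
  have hx2 : ‖x‖ ^ 2 = ‖kz‖ ^ 2 - ‖inner ℂ kw kz‖ ^ 2 / ‖kw‖ ^ 2 := by
    have hre : RCLike.re (inner ℂ kz ((inner ℂ kw kz / (‖kw‖ : ℂ) ^ 2) • kw))
        = ‖inner ℂ kw kz‖ ^ 2 / ‖kw‖ ^ 2 := by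
      rw [inner_smul_right, ← inner_conj_symm kz kw, div_mul_eq_mul_div, Complex.mul_conj']
      norm_cast
    rw [hx, @norm_sub_sq ℂ, hre, norm_smul, norm_div, norm_pow, Complex.norm_real, norm_norm]
    field_simp
    ring
  -- Since `φ(w) = 0`, the `kw` part of `x` pairs to zero with the range of `φ`.
  have h1 : inner ℂ x (φ.1 kz) = eval φ z * (‖kz‖ : ℂ) ^ 2 := by
    rw [hx, inner_sub_left, inner_smul_left, inner_kernelVector_apply_eq_eval_mul,
      inner_kernelVector_apply_eq_eval_mul, hw, inner_self_eq_norm_sq_to_K]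
    simp [kz]
  have h2 : ‖eval φ z‖ * ‖kz‖ ^ 2 ≤ ‖x‖ * ‖kz‖ := by
    calc ‖eval φ z‖ * ‖kz‖ ^ 2 = ‖inner ℂ x (φ.1 kz)‖ := by rw [h1]; simp
      _ ≤ ‖x‖ * ‖φ.1 kz‖ := norm_inner_le_norm _ _
      _ ≤ ‖x‖ * ‖kz‖ := by
        gcongr
        exact (φ.1.le_of_opNorm_le hφ kz).trans_eq (one_mul _)
  have h3 : ‖eval φ z‖ ^ 2 * ‖kz‖ ^ 2 ≤ ‖x‖ ^ 2 := by
    have := pow_le_pow_left₀ (by positivity) h2 2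
    refine le_of_mul_le_mul_right ?_ hkz0
    calc _ = (‖eval φ z‖ * ‖kz‖ ^ 2) ^ 2 := by ring
      _ ≤ _ := this
      _ = _ := by ring
  refine (sq_le_sq₀ (norm_nonneg _) (norm_nonneg _)).1 ?_
  rw [norm_sq_ballInvolution hz1 hw1]
  refine le_of_mul_le_mul_right (h3.trans_eq ?_) hkz0
  rw [hx2, hkz, hkw, hzw]
  field_simp

end hardyAlgebra

/-! ### Norm identities for row contractions -/

/-- Vector form of the numerator identity in `norm_sq_ballInvolution`, which is the case `H = ℂ`, `y
= 1`, `v j = conj (z j)`. It is used with `v j = S_j* y`, where the last bracket is nonnegative. -/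
theorem sum_norm_sq_sub_smul {H : Type*} [NormedAddCommGroup H] [InnerProductSpace ℂ H] {n : ℕ}
    (a : EuclideanSpace ℂ (Fin n)) {s : ℝ} (hs0 : 0 ≤ s) (hs : s ^ 2 = 1 - ‖a‖ ^ 2) (y : H)
    (v : Fin n → H) :
    ∑ j, ‖star (a j) • (y - ((1 + s : ℝ) : ℂ)⁻¹ • ∑ i, a i • v i) - (s : ℂ) • v j‖ ^ 2
      = ‖y - ∑ i, a i • v i‖ ^ 2 - s ^ 2 * (‖y‖ ^ 2 - ∑ j, ‖v j‖ ^ 2) := by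
  set t := ∑ i, a i • v i with ht
  set p := y - ((1 + s : ℝ) : ℂ)⁻¹ • t with hp
  have h1 : 1 + s ≠ 0 := by positivity
  have hj : ∀ j, ‖star (a j) • p - (s : ℂ) • v j‖ ^ 2
      = ‖a j‖ ^ 2 * ‖p‖ ^ 2 - 2 * s * RCLike.re (inner ℂ p (a j • v j)) + s ^ 2 * ‖v j‖ ^ 2 := by
    intro j
    rw [@norm_sub_sq ℂ, norm_smul, norm_smul, inner_smul_left, inner_smul_right, inner_smul_right]
    have : (starRingEnd ℂ) (star (a j)) * ((s : ℂ) * inner ℂ p (v j))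
        = (s : ℂ) * (a j * inner ℂ p (v j)) := by
      simp; ring
    rw [this, RCLike.re_to_complex, Complex.re_ofReal_mul, norm_star, Complex.norm_real,
      Real.norm_of_nonneg hs0, RCLike.re_to_complex]
    ring
  have hsum : ∑ j, RCLike.re (inner ℂ p (a j • v j)) = RCLike.re (inner ℂ p t) := by
    rw [ht, inner_sum, map_sum]
  rw [Finset.sum_congr rfl fun j _ => hj j, Finset.sum_add_distrib, Finset.sum_sub_distrib,
    ← Finset.sum_mul, ← Finset.mul_sum, ← Finset.mul_sum, hsum, ← EuclideanSpace.norm_sq_eq]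
  have hp2 : ‖p‖ ^ 2 = ‖y‖ ^ 2 - 2 * (1 + s)⁻¹ * RCLike.re (inner ℂ y t)
      + (1 + s)⁻¹ ^ 2 * ‖t‖ ^ 2 := by
    rw [hp, @norm_sub_sq ℂ, norm_smul, inner_smul_right, ← Complex.ofReal_inv,
      RCLike.re_to_complex, Complex.re_ofReal_mul, Complex.norm_real,
      Real.norm_of_nonneg (by positivity), RCLike.re_to_complex]
    ring
  have hpt : RCLike.re (inner ℂ p t) = RCLike.re (inner ℂ y t) - (1 + s)⁻¹ * ‖t‖ ^ 2 := by
    rw [hp, inner_sub_left, inner_smul_left, inner_self_eq_norm_sq_to_K, map_sub,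
      ← Complex.ofReal_inv, Complex.conj_ofReal, RCLike.re_to_complex, RCLike.re_to_complex,
      Complex.re_ofReal_mul]
    congr 2
    norm_cast
  rw [hp2, hpt, @norm_sub_sq ℂ, show ‖a‖ ^ 2 = 1 - s ^ 2 by rw [hs]; ring]
  field_simp
  ring

theorem norm_sum_smul_sq_le {H : Type*} [NormedAddCommGroup H] [NormedSpace ℂ H] {n : ℕ}
    (c : EuclideanSpace ℂ (Fin n)) (v : Fin n → H) :
    ‖∑ j, c j • v j‖ ^ 2 ≤ ‖c‖ ^ 2 * ∑ j, ‖v j‖ ^ 2 := by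
  have h : ‖∑ j, c j • v j‖ ≤ ∑ j, ‖c j‖ * ‖v j‖ :=
    (norm_sum_le _ _).trans_eq (Finset.sum_congr rfl fun j _ => norm_smul _ _)
  rw [EuclideanSpace.norm_sq_eq]
  exact (pow_le_pow_left₀ (norm_nonneg _) h 2).trans (Finset.sum_mul_sq_le_sq_mul_sq _ _ _)

/-! ### Extremal elements of the algebra -/

namespace hardyAlgebra

open FockSpace ContinuousLinearMap

variable {n : ℕ}

/-- The norm topology is finer than the weak operator topology. The resulting completeness allows
Neumann series inside the algebra. -/
theorem isClosed (n : ℕ) : IsClosed (hardyAlgebra n : Set (FockSpace n →L[ℂ] FockSpace n)) := by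
  have h : (hardyAlgebra n : Set (FockSpace n →L[ℂ] FockSpace n)) =
      ContinuousLinearMapWOT.ofCLM ⁻¹' closure (Algebra.adjoin ℂ (Set.range fun j : Fin n =>
        ContinuousLinearMapWOT.ofCLM (creation j)) : Set (FockSpace n →WOT[ℂ] FockSpace n)) :=
    Set.ext fun _ => mem_iff
  rw [h]
  exact isClosed_closure.preimage ContinuousLinearMapWOT.continuous_ofCLM

instance : CompleteSpace (hardyAlgebra n) := (isClosed n).completeSpace_coe

/-- The element `∑ conj (a_j) S_j` of `F_n^∞`, whose value at `l` is `⟪a, l⟫`. -/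
noncomputable def linearForm (a : EuclideanSpace ℂ (Fin n)) : hardyAlgebra n :=
  ∑ j, star (a j) • S j

theorem coe_linearForm (a : EuclideanSpace ℂ (Fin n)) :
    (linearForm a : FockSpace n →L[ℂ] FockSpace n) = ∑ j, star (a j) • creation j := by
  simp [linearForm, S]

theorem eval_linearForm (a : EuclideanSpace ℂ (Fin n)) (l : UnitBall n) :
    eval (linearForm a) l = inner ℂ a l.1 := by
  have h := eval_S l
  simp only [eval] at h
  simp [eval, linearForm, h, PiLp.inner_apply, mul_comm]

theorem adjoint_linearForm_apply (a : EuclideanSpace ℂ (Fin n)) (y : FockSpace n) :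
    adjoint (linearForm a).1 y = ∑ j, a j • adjoint (creation j) y := by
  rw [coe_linearForm]
  simp only [map_sum, map_smulₛₗ, sum_apply, smul_apply, starRingEnd_apply, star_star]

theorem norm_linearForm_le (a : EuclideanSpace ℂ (Fin n)) : ‖linearForm a‖ ≤ ‖a‖ := by
  change ‖(linearForm a).1‖ ≤ ‖a‖
  rw [← LinearIsometryEquiv.norm_map adjoint]
  refine opNorm_le_bound _ (norm_nonneg a) fun y => ?_
  refine (sq_le_sq₀ (norm_nonneg _) (by positivity)).1 ?_
  rw [adjoint_linearForm_apply, mul_pow]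
  refine (norm_sum_smul_sq_le _ _).trans ?_
  gcongr
  exact sum_norm_sq_adjoint_creation_le y

/-- The numerator of `∑ conj (c_j) (f_a)_j`, where `f_a` is the involution of the ball which
exchanges `0` and `a`. -/
noncomputable def involutionNumerator (a c : EuclideanSpace ℂ (Fin n)) : hardyAlgebra n :=
  inner ℂ c a • (1 - ((1 + √(1 - ‖a‖ ^ 2) : ℝ) : ℂ)⁻¹ • linearForm a)
    - (√(1 - ‖a‖ ^ 2) : ℂ) • linearForm c

theorem norm_adjoint_involutionNumerator_le {a c : EuclideanSpace ℂ (Fin n)} (ha : ‖a‖ < 1)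
    (hc : ‖c‖ ≤ 1) (y : FockSpace n) :
    ‖adjoint (involutionNumerator a c).1 y‖ ≤ ‖adjoint (1 - linearForm a).1 y‖ := by
  have hs := sq_sqrt_one_sub_norm_sq ha
  have hs0 := Real.sqrt_nonneg (1 - ‖a‖ ^ 2)
  have h1 : adjoint (1 - linearForm a).1 y = y - ∑ j, a j • adjoint (creation j) y := by
    rw [← adjoint_linearForm_apply]
    simp [one_def, adjoint_id]
  have h2 : adjoint (involutionNumerator a c).1 y = ∑ j, c j • (star (a j) •
      (y - ((1 + √(1 - ‖a‖ ^ 2) : ℝ) : ℂ)⁻¹ • ∑ i, a i • adjoint (creation i) y)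
        - (√(1 - ‖a‖ ^ 2) : ℂ) • adjoint (creation j) y) := by
    have h3 : adjoint (involutionNumerator a c).1 y = (inner ℂ a c : ℂ) •
        (y - ((1 + √(1 - ‖a‖ ^ 2) : ℝ) : ℂ)⁻¹ • adjoint (linearForm a).1 y)
        - (√(1 - ‖a‖ ^ 2) : ℂ) • adjoint (linearForm c).1 y := by
      have h4 : (involutionNumerator a c).1 = inner ℂ c a • (ContinuousLinearMap.id ℂ (FockSpace n)
          - ((1 + √(1 - ‖a‖ ^ 2) : ℝ) : ℂ)⁻¹ • (linearForm a).1)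
          - (√(1 - ‖a‖ ^ 2) : ℂ) • (linearForm c).1 := rfl
      simp only [h4, map_sub, map_smulₛₗ, sub_apply, smul_apply, adjoint_id, map_inv₀,
        Complex.conj_ofReal, inner_conj_symm, id_apply]
    rw [h3, adjoint_linearForm_apply, adjoint_linearForm_apply]
    simp only [smul_sub (c _), Finset.sum_sub_distrib, smul_smul (c _), ← Finset.sum_smul]
    rw [PiLp.inner_apply]
    simp only [Finset.smul_sum, smul_smul, mul_comm, RCLike.inner_apply, starRingEnd_apply]
  refine (sq_le_sq₀ (norm_nonneg _) (norm_nonneg _)).1 ?_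
  rw [h1, h2]
  refine (norm_sum_smul_sq_le _ _).trans ?_
  have h4 := sum_norm_sq_adjoint_creation_le y
  have h5 : ‖c‖ ^ 2 ≤ 1 := pow_le_one₀ (norm_nonneg _) hc
  refine (mul_le_of_le_one_left (Finset.sum_nonneg fun j _ => sq_nonneg _) h5).trans ?_
  rw [sum_norm_sq_sub_smul a hs0 hs]
  nlinarith [sq_nonneg (√(1 - ‖a‖ ^ 2))]

theorem eval_involutionNumerator (a c : EuclideanSpace ℂ (Fin n)) (l : UnitBall n) :
    eval (involutionNumerator a c) l = inner ℂ c (a - (√(1 - ‖a‖ ^ 2) : ℂ) • l.1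
      - (inner ℂ a l.1 / (1 + √(1 - ‖a‖ ^ 2)) : ℂ) • a) := by
  have h1 := eval_linearForm a l
  have h2 := eval_linearForm c l
  simp only [eval] at h1 h2
  simp only [eval, involutionNumerator, map_sub, map_smul, map_one, h1, h2, inner_sub_right,
    inner_smul_right, smul_eq_mul]
  push_cast
  ring

/-- The composition of a linear form of norm at most `1` with the involution of the ball
which exchanges `0` and `a` is the evaluation of a contraction in `F_n^∞`. -/
theorem exists_eval_eq_inner_ballInvolution {a c : EuclideanSpace ℂ (Fin n)} (ha : ‖a‖ < 1)
    (hc : ‖c‖ ≤ 1) :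
    ∃ φ : hardyAlgebra n, ‖φ‖ ≤ 1 ∧ ∀ l : UnitBall n, eval φ l = inner ℂ c (ballInvolution a l.1) := by
  -- The Neumann series inverts `1 - L_a` within the algebra, as `‖L_a‖ ≤ ‖a‖ < 1`.
  let u := Units.oneSub (linearForm a) ((norm_linearForm_le a).trans_lt ha)
  have hu : (u : hardyAlgebra n) = 1 - linearForm a := rfl
  refine ⟨(u⁻¹ : (hardyAlgebra n)ˣ) * involutionNumerator a c, ?_, fun l => ?_⟩
  · change ‖((u⁻¹ : (hardyAlgebra n)ˣ) : hardyAlgebra n).1 * (involutionNumerator a c).1‖ ≤ 1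
    rw [← LinearIsometryEquiv.norm_map adjoint]
    refine opNorm_le_bound _ zero_le_one fun y => ?_
    rw [mul_def, adjoint_comp, comp_apply]
    -- The comparison is applied at the vector `(u⁻¹)* y`, where its right side is `‖u* (u⁻¹)* y‖ =
    -- ‖y‖`.
    refine (norm_adjoint_involutionNumerator_le ha hc _).trans ?_
    rw [← hu, ← comp_apply, ← adjoint_comp, ← mul_def]
    have h : ((u⁻¹ : (hardyAlgebra n)ˣ) : hardyAlgebra n).1 * (u : hardyAlgebra n).1 = 1 :=
      congrArg Subtype.val u.inv_mul
    rw [h]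
    simp [one_def, adjoint_id]
  · have h2 : eval ((u⁻¹ : (hardyAlgebra n)ˣ) : hardyAlgebra n) l = (1 - inner ℂ a l.1)⁻¹ := by
      refine eq_inv_of_mul_eq_one_left ?_
      rw [← eval_linearForm]
      have := congrArg (representationAt l) u.inv_mul
      rwa [map_mul, hu, map_sub, map_one] at this
    refine (map_mul (representationAt l) _ _).trans ?_
    rw [ballInvolution, inner_smul_right, ← eval_involutionNumerator, ← h2]
    rfl

end hardyAlgebra

theorem mainTheorem4 (n : ℕ) (hn : 0 < n) (z w : UnitBall n) :
    pseudohyperbolicValues z w = {pseudohyperbolicDist z w} ∧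
      IsGreatest {r : ℝ | ∃ φ : hardyAlgebra n, ‖φ‖ ≤ 1 ∧ hardyAlgebra.eval φ w = 0 ∧ r = ‖hardyAlgebra.eval φ z‖}
        (pseudohyperbolicDist z w) := by
  have hz : ‖z.1‖ < 1 := mem_ball_zero_iff.1 z.2
  have hw : ‖w.1‖ < 1 := mem_ball_zero_iff.1 w.2
  rw [pseudohyperbolicDist_eq]
  refine ⟨pseudohyperbolicValues_eq z w, ?_, ?_⟩
  -- The involution is based at `w`, so that the function vanishes there; its norm at `z` is the
  -- distance by symmetry. If `v = 0`, the convention `0⁻¹ = 0` makes the functional zero, which is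
  -- still extremal.
  · set v := ballInvolution w.1 z.1 with hv
    have hc : ‖((‖v‖ : ℂ)⁻¹ • v)‖ ≤ 1 := by
      rw [norm_smul, norm_inv, Complex.norm_real, norm_norm]
      exact inv_mul_le_one
    obtain ⟨φ, hφ, he⟩ := hardyAlgebra.exists_eval_eq_inner_ballInvolution hw hc
    refine ⟨φ, hφ, ?_, ?_⟩
    · rw [he, ballInvolution_self hw, inner_zero_right]
    · rw [he, ← hv, inner_smul_left, inner_self_eq_norm_sq_to_K, norm_ballInvolution_comm hz hw,
        ← hv]
      rcases eq_or_ne ‖v‖ 0 with h0 | h0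
      · simp [h0]
      · simp
        field_simp
  · rintro r ⟨φ, hφ, h0, rfl⟩
    exact hardyAlgebra.norm_eval_le hφ h0
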